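/- Let $k$ be a field of characteristic $p>0$. A power series $f\in k[[t]]$ is called algebraic if it is algebraic over $k(t)$; its degree (equal to $[k(t)(f):k(t)]$) is the minimal degree in $y$, and its height is the minimal degree in $t$, of a nonzero polynomial $A(t,y)\in k[t,y]$ such that $A(t,f)=0$. For $f(t)=\sum_{i\ge 0}a(i)t^i$ and $g(t)=\sum_{i\ge 0}b(i)t^i$ in $k[[t]]$ and parameters $\alpha,\beta,\gamma\in k$, define the Lamperti product \[ f\circ_{\mathrm L} g=\sum_{i\ge 0}\Bigl(\sum_{j+m+\ell=i}\frac{i!}{j!\,m!\,\ell!}\,\alpha^{j}\beta^{\ell}\gamma^{m}\,a(j+m)\,b(\ell+m)\Bigr)t^i , \] the Hadamard product $f\odot g=\sum_{i\ge 0}a(i)b(i)t^i$, and the Hurwitz product \[ f\circ_{\mathrm H} g=\sum_{i\ge 0}\Bigl(\sum_{j=0}^{i}\binom{i}{j}a(j)b(i-j)\Bigr)t^i . \] **Theorem 8.** Let $f,g\in k[[t]]$ be algebraic power series of degrees $d$ and $d'$ and heights $h$ and $h'$, respectively, and set $N=(d+1)(d'+1)(h+1)(h'+1)$. Then, for all $\alpha,\beta,\gamma\in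 k$, the Lamperti product $f\circ_{\mathrm L}g$ is an algebraic power series of degree at most $p^N-1$ over $k(t)$. In particular, $f\odot g$ and $f\circ_{\mathrm H}g$ are algebraic power series of degree at most $p^N-1$ over $k(t)$. -/

import Mathlib

open scoped Nat RatFunc

noncomputable section

namespace AlgSeries

variable {k : Type*} [Field k]

/-- A univariate power series is algebraic if it is algebraic over the field `k(t)` of rational
functions, both being embedded in the field `k((t))` of formal Laurent series. -/
def IsAlg (f : PowerSeries k) : Prop :=
  IsAlgebraic (RatFunc k) (algebraMap (PowerSeries k) (LaurentSeries k) f)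

/-- The degree in `t` of a polynomial `A(t, y) ∈ k[t, y]`, seen as a polynomial in `y` with
coefficients in `k[t]`. -/
def degT (A : Polynomial (Polynomial k)) : ℕ :=
  A.support.sup fun j => (A.coeff j).natDegree

/-- The nonzero polynomials `A(t, y) ∈ k[t, y]` with `A(t, f) = 0`. -/
def annihilators (f : PowerSeries k) : Set (Polynomial (Polynomial k)) :=
  {A | A ≠ 0 ∧ Polynomial.aeval f A = 0}

/-- The degree of an algebraic power series `f`: the minimal degree in `y` of a nonzero polynomial
`A(t, y)` with `A(t, f) = 0` (equivalently `[k(t)(f) : k(t)]`). Only meaningful when `f` is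
algebraic. -/
def degree (f : PowerSeries k) : ℕ :=
  sInf (Polynomial.natDegree '' annihilators f)

/-- The height of an algebraic power series `f`: the minimal degree in `t` of a nonzero polynomial
`A(t, y)` with `A(t, f) = 0`. Only meaningful when `f` is algebraic. -/
def height (f : PowerSeries k) : ℕ :=
  sInf (degT '' annihilators f)

/-- The Hadamard product `∑ a(i) b(i) tⁱ`. -/
def hadamard (f g : PowerSeries k) : PowerSeries k :=
  PowerSeries.mk fun i => PowerSeries.coeff i f * PowerSeries.coeff i g

/-- The Hurwitz product `∑ᵢ (∑_{j ≤ i} (i choose j) a(j) b(i - j)) tⁱ`. -/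
def hurwitz (f g : PowerSeries k) : PowerSeries k :=
  PowerSeries.mk fun i => ∑ j ∈ Finset.range (i + 1),
    (i.choose j : k) * PowerSeries.coeff j f * PowerSeries.coeff (i - j) g

/-- The Lamperti product with parameters `α, β, γ`: its `i`-th coefficient is the sum over all
`(j, m, l)` with `j + m + l = i` of `i! / (j! m! l!) * αʲ βˡ γᵐ a(j + m) b(l + m)`. Here
`j = x 0`, `m = x 1`, `l = x 2`; the multinomial coefficient is an (exact) quotient of natural
numbers, cast to `k`. -/
def lamperti (α β γ : k) (f g : PowerSeries k) : PowerSeries k :=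
  PowerSeries.mk fun i => ∑ x ∈ Finset.Nat.antidiagonalTuple 3 i,
    ((i ! / ((x 0)! * (x 1)! * (x 2)!) : ℕ) : k) * α ^ x 0 * β ^ x 2 * γ ^ x 1 *
      PowerSeries.coeff (x 0 + x 1) f * PowerSeries.coeff (x 2 + x 1) g

end AlgSeries

end

noncomputable section

namespace AlgSeries

/-! Over a perfect field K of characteristic p, every series splits uniquely as f = ∑ tˢ (C_s f)ᵖ
with s < p. The argument bounds finite-dimensional K-spaces stable under the section operators C_s
(`cartier`).

Stability implies algebraicity (`exists_annihilator_of_stable`): if dim V ≤ N, the K[t]-modules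
spanned by the pˢ-th powers of V increase with s. Hence u, uᵖ, …, u^(p^N) lie in one module with at
most N generators and are dependent; dividing the relation by u gives degree at most p^N - 1.

Conversely (`exists_stable_submodule`), let A be the minimal polynomial of f. It is separable
because K is perfect. The series w for which A'(f) w is a value P(f) with deg_y P ≤ d and deg_t P ≤
h form a stable space of dimension at most (d+1)(h+1). The key identity, `sum_coeff_mul_pow_eq`,
extracts from P A^(p-1) the exponents congruent to p-1.

The i-th Lamperti coefficient is a pairing of (αx + γxy + βy)^i with f and g. Frobenius then
expresses each section of the product through products of sections with the same parameters
(`cartier_lamperti`), so the products of two stable spaces span a stable space, of dimension at most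
N. The passage from k to its algebraic closure is undone by a k-linear functional
(`exists_annihilator_of_map`). -/

lemma algebraMap_polynomial_eq_coe {K : Type*} [Field K] (c : Polynomial K) :
    algebraMap (Polynomial K) (PowerSeries K) c = (c : PowerSeries K) := by
  simp [PowerSeries.algebraMap_apply']

/-! ### Section operators over a perfect field -/

section Cartier

variable {K : Type*} [Field K] {p : ℕ} [Fact p.Prime] [CharP K p]

lemma coeff_pow_char (g : PowerSeries K) (n : ℕ) :
    PowerSeries.coeff n (g ^ p) =
      if p ∣ n then PowerSeries.coeff (n / p) g ^ p else 0 := by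
  have hp : p ≠ 0 := (Fact.out : p.Prime).ne_zero
  have h : PowerSeries.map (frobenius K p) (PowerSeries.expand p hp g) = g ^ p :=
    MvPowerSeries.map_frobenius_expand p hp
  rw [← h, PowerSeries.coeff_map, PowerSeries.coeff_expand]
  split_ifs <;> simp [frobenius_def, hp]

variable [PerfectRing K p]

variable (p) in
/-- The section operator `∑ a(n) tⁿ ↦ ∑ a(p n + r)^(1/p) tⁿ`. -/
def cartier (r : ℕ) : PowerSeries K →+ PowerSeries K where
  toFun f := PowerSeries.mk fun n =>
    (frobeniusEquiv K p).symm (PowerSeries.coeff (p * n + r) f)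
  map_zero' := by ext; simp
  map_add' f g := by ext; simp

@[simp] lemma coeff_cartier (r n : ℕ) (f : PowerSeries K) :
    PowerSeries.coeff n (cartier p r f) =
      (frobeniusEquiv K p).symm (PowerSeries.coeff (p * n + r) f) := by
  simp [cartier]

lemma cartier_X_pow_mul_pow {r s : ℕ} (hr : r < p) (hs : s < p) (g : PowerSeries K) :
    cartier p r (PowerSeries.X ^ s * g ^ p) = if s = r then g else 0 := by
  have hp : 0 < p := by omega
  ext n
  rw [coeff_cartier, PowerSeries.coeff_X_pow_mul', coeff_pow_char]
  by_cases hsr : s = r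
  · subst hsr
    simp [hp]
  · rw [if_neg hsr, map_zero]
    split_ifs with h1 h2
    · exfalso
      apply hsr
      have h3 : s ≡ p * n + r [MOD p] := (Nat.modEq_iff_dvd' h1).2 h2
      have h4 : s % p = r % p := by simpa [Nat.ModEq] using h3
      rwa [Nat.mod_eq_of_lt hr, Nat.mod_eq_of_lt hs] at h4
    · simp
    · simp

/-- Exponents are grouped by residue modulo p; perfectness makes each group tˢ times a p-th power.
-/
lemma sum_X_pow_mul_cartier_pow (f : PowerSeries K) :
    ∑ s ∈ Finset.range p, PowerSeries.X ^ s * cartier p s f ^ p = f := by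
  have hp : 0 < p := (Fact.out : p.Prime).pos
  ext n
  rw [map_sum, Finset.sum_eq_single (n % p)]
  · rw [PowerSeries.coeff_X_pow_mul', coeff_pow_char, if_pos (Nat.mod_le _ _),
      if_pos (Nat.dvd_sub_mod n), coeff_cartier, frobeniusEquiv_symm_pow_p,
      Nat.mul_div_cancel' (Nat.dvd_sub_mod n), Nat.sub_add_cancel (Nat.mod_le _ _)]
  · intro s hs hne
    rw [PowerSeries.coeff_X_pow_mul', coeff_pow_char]
    split_ifs with h1 h2
    · exfalso
      apply hne
      have h3 : s % p = n % p := (Nat.modEq_iff_dvd' h1).2 h2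
      rwa [Nat.mod_eq_of_lt (Finset.mem_range.1 hs)] at h3
    · rfl
    · rfl
  · intro h
    exact absurd (Finset.mem_range.2 (Nat.mod_lt n hp)) h

/-- Multiplying the decomposition of a by bᵖ gives the decomposition of a bᵖ, which is unique. -/
lemma cartier_mul_pow {r : ℕ} (hr : r < p) (a b : PowerSeries K) :
    cartier p r (a * b ^ p) = cartier p r a * b := by
  have h : a * b ^ p =
      ∑ s ∈ Finset.range p, PowerSeries.X ^ s * (cartier p s a * b) ^ p := by
    conv_lhs => rw [← sum_X_pow_mul_cartier_pow (p := p) a]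
    rw [Finset.sum_mul]
    exact Finset.sum_congr rfl fun s _ => by rw [mul_pow, mul_assoc]
  rw [h, map_sum, Finset.sum_eq_single r]
  · rw [cartier_X_pow_mul_pow hr hr, if_pos rfl]
  · intro s hs hne
    rw [cartier_X_pow_mul_pow hr (Finset.mem_range.1 hs), if_neg hne]
  · intro h
    exact absurd (Finset.mem_range.2 hr) h

lemma cartier_smul (r : ℕ) (c : K) (a : PowerSeries K) :
    cartier p r (c • a) = (frobeniusEquiv K p).symm c • cartier p r a := by
  ext n
  simp

variable (p) in
/-- The section operator on polynomials. -/
def cartierPoly (r : ℕ) (c : Polynomial K) : Polynomial K :=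
  PowerSeries.trunc (c.natDegree / p + 1) (cartier p r (c : PowerSeries K))

lemma coe_cartierPoly (r : ℕ) (c : Polynomial K) :
    (cartierPoly p r c : PowerSeries K) = cartier p r (c : PowerSeries K) := by
  have hp : 0 < p := (Fact.out : p.Prime).pos
  ext n
  rw [Polynomial.coeff_coe, cartierPoly, PowerSeries.coeff_trunc]
  split_ifs with h
  · rfl
  · rw [coeff_cartier, Polynomial.coeff_coe, Polynomial.coeff_eq_zero_of_natDegree_lt, map_zero]
    have h1 : c.natDegree / p < n := by omega
    have h2 := (Nat.div_lt_iff_lt_mul hp).1 h1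
    rw [mul_comm] at h2
    omega

/-- This division by p brings the t-degree of P A^(p-1), at most p h, back to h. -/
lemma natDegree_cartierPoly_le (r : ℕ) (c : Polynomial K) :
    (cartierPoly p r c).natDegree ≤ c.natDegree / p :=
  Nat.lt_succ_iff.1 (PowerSeries.natDegree_trunc_lt _ _)

@[simp] lemma cartierPoly_zero (r : ℕ) : cartierPoly p r (0 : Polynomial K) = 0 := by
  apply Polynomial.coe_injective
  rw [coe_cartierPoly]
  simp

lemma exists_cartierPoly_ne_zero {c : Polynomial K} (hc : c ≠ 0) :
    ∃ r < p, cartierPoly p r c ≠ 0 := by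
  by_contra! h
  apply hc
  apply Polynomial.coe_injective
  rw [← sum_X_pow_mul_cartier_pow (p := p) (c : PowerSeries K)]
  rw [Finset.sum_eq_zero, Polynomial.coe_zero]
  intro s hs
  rw [← coe_cartierPoly, h s (Finset.mem_range.1 hs), Polynomial.coe_zero,
    zero_pow (Fact.out : p.Prime).ne_zero, mul_zero]

end Cartier

/-! ### Stable finite-dimensional spaces consist of algebraic series -/

/-- An element of a finite-dimensional space stable under the section operators is algebraic. -/
theorem exists_annihilator_of_stable {K : Type*} [Field K] {p : ℕ} [Fact p.Prime] [CharP K p]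
    [PerfectRing K p] (V : Submodule K (PowerSeries K)) [FiniteDimensional K V]
    (hV : ∀ r < p, ∀ v ∈ V, cartier p r v ∈ V) {N : ℕ} (hN : Module.finrank K V ≤ N)
    (hN1 : 1 ≤ N) {u : PowerSeries K} (hu : u ∈ V) :
    ∃ B : Polynomial (Polynomial K), B ≠ 0 ∧ B.natDegree ≤ p ^ N - 1 ∧
      Polynomial.aeval u B = 0 := by
  classical
  have hp : p.Prime := Fact.out
  have hpN : 2 ≤ p ^ N := hp.two_le.trans (Nat.le_self_pow (by omega) p)
  -- The relation found below is divided by u, so u = 0 is separate; there y has degree 1 ≤ p^N - 1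
  -- because N ≥ 1.
  by_cases hu0 : u = 0
  · refine ⟨Polynomial.X, Polynomial.X_ne_zero, ?_, by simp [hu0]⟩
    rw [Polynomial.natDegree_X]
    omega
  have : CharP (PowerSeries K) p := charP_of_injective_algebraMap
    (algebraMap K (PowerSeries K)).injective p
  let b := Module.finBasis K V
  let E : ℕ → Submodule (Polynomial K) (PowerSeries K) := fun s =>
    Submodule.span _ (Set.range fun i => (b i : PowerSeries K) ^ p ^ s)
  have hE : ∀ s, ∀ v ∈ V, v ^ p ^ s ∈ E s := by
    intro s v hv
    have h1 := congrArg (fun x : V => (x : PowerSeries K)) (b.sum_repr ⟨v, hv⟩)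
    simp only [Submodule.coe_sum, Submodule.coe_smul] at h1
    rw [← h1, sum_pow_char_pow]
    refine Submodule.sum_mem _ fun i _ => ?_
    rw [PowerSeries.smul_eq_C_mul, mul_pow, ← map_pow]
    have h2 := (E s).smul_mem (Polynomial.C ((b.repr ⟨v, hv⟩) i ^ p ^ s))
      (Submodule.subset_span ⟨i, rfl⟩ : (b i : PowerSeries K) ^ p ^ s ∈ E s)
    rw [Algebra.smul_def] at h2
    convert h2 using 2
    simp [algebraMap_polynomial_eq_coe]
  -- The pˢ-th power of b = ∑ tʳ (C_r b)ᵖ involves p^(s+1)-th powers of the C_r b, which stay in V.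
  have hmono : ∀ s, E s ≤ E (s + 1) := by
    intro s
    refine Submodule.span_le.2 ?_
    rintro _ ⟨i, rfl⟩
    simp only [SetLike.mem_coe]
    rw [← sum_X_pow_mul_cartier_pow (p := p) (b i : PowerSeries K), sum_pow_char_pow]
    refine Submodule.sum_mem _ fun r hr => ?_
    rw [mul_pow, ← pow_mul, ← pow_mul, ← pow_succ']
    have h2 := (E (s + 1)).smul_mem (Polynomial.X ^ (r * p ^ s))
      (hE (s + 1) _ (hV r (Finset.mem_range.1 hr) _ (b i).2))
    rw [Algebra.smul_def] at h2
    convert h2 using 2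
    simp [algebraMap_polynomial_eq_coe]
  have hmono' : Monotone E := monotone_nat_of_le_succ hmono
  have hdep : ¬ LinearIndependent (Polynomial K) fun s : Fin (N + 1) => u ^ p ^ (s : ℕ) := by
    intro hli
    have h := linearIndependent_le_span_aux' _ hli
      (Set.range fun i => (b i : PowerSeries K) ^ p ^ N) (by
        rintro _ ⟨s, rfl⟩
        exact hmono' (Nat.lt_succ_iff.1 s.2) (hE s u hu))
    have h2 := Fintype.card_range_le fun i => (b i : PowerSeries K) ^ p ^ N
    simp only [Fintype.card_fin] at h h2
    omega
  rw [Fintype.not_linearIndependent_iff] at hdep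
  obtain ⟨c, hc, s₀, hs₀⟩ := hdep
  have hdeg : ∀ s : Fin (N + 1), p ^ (s : ℕ) - 1 ≤ p ^ N - 1 := fun s =>
    Nat.sub_le_sub_right (Nat.pow_le_pow_right hp.pos (Nat.lt_succ_iff.1 s.2)) 1
  have hpos : ∀ s : ℕ, 1 ≤ p ^ s := fun s => Nat.one_le_pow _ _ hp.pos
  -- The exponents pˢ - 1 come from dividing ∑ c_s u^(pˢ) = 0 by u; they are distinct, so no
  -- coefficients cancel.
  refine ⟨∑ s : Fin (N + 1), Polynomial.monomial (p ^ (s : ℕ) - 1) (c s), ?_, ?_, ?_⟩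
  · intro h0
    apply hs₀
    have h1 := congrArg (Polynomial.coeff · (p ^ (s₀ : ℕ) - 1)) h0
    simp only [Polynomial.finsetSum_coeff, Polynomial.coeff_monomial,
      Polynomial.coeff_zero] at h1
    rw [Finset.sum_eq_single s₀] at h1
    · simpa using h1
    · intro s _ hne
      rw [if_neg]
      intro h
      apply hne
      have h3 : p ^ (s : ℕ) = p ^ (s₀ : ℕ) := by
        have := hpos s
        have := hpos s₀
        omega
      exact Fin.ext (Nat.pow_right_injective hp.two_le h3)
    · simp
  · exact Polynomial.natDegree_sum_le_of_forall_le _ _ fun s _ =>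
      (Polynomial.natDegree_monomial_le _).trans (hdeg s)
  · have h1 : u * Polynomial.aeval u
        (∑ s : Fin (N + 1), Polynomial.monomial (p ^ (s : ℕ) - 1) (c s)) = 0 := by
      rw [← hc, map_sum, Finset.mul_sum]
      refine Finset.sum_congr rfl fun s _ => ?_
      rw [Polynomial.aeval_monomial, Algebra.smul_def, mul_left_comm, ← pow_succ',
        Nat.sub_add_cancel (hpos s)]
    exact (mul_eq_zero.1 h1).resolve_left hu0

/-! ### Degree in t -/

open Polynomial in
lemma coeff_coeff_swap {k : Type*} [Field k] (A : Polynomial (Polynomial k)) (i j : ℕ) :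
    ((Bivariate.swap A).coeff i).coeff j = (A.coeff j).coeff i := by
  induction A using Polynomial.induction_on' with
  | add A B hA hB => simp [hA, hB]
  | monomial n c =>
    induction c using Polynomial.induction_on' with
    | add a b ha hb => simp only [map_add, coeff_add, ha, hb]
    | monomial m r =>
      rw [Bivariate.swap_monomial_monomial]
      simp only [coeff_monomial]
      split_ifs <;> simp_all [coeff_monomial]

section DegT

variable {k : Type*} [Field k]

lemma degT_le_iff {A : Polynomial (Polynomial k)} {h : ℕ} :
    degT A ≤ h ↔ ∀ j, (A.coeff j).natDegree ≤ h := by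
  rw [degT, Finset.sup_le_iff]
  refine ⟨fun H j => ?_, fun H j _ => H j⟩
  by_cases hj : j ∈ A.support
  · exact H j hj
  · rw [Polynomial.notMem_support_iff.1 hj]
    simp

/-- Exchanging t and y reduces products, powers and divisors to the ordinary degree. -/
lemma degT_eq_natDegree_swap (A : Polynomial (Polynomial k)) :
    degT A = (Polynomial.Bivariate.swap A).natDegree := by
  apply le_antisymm
  · refine degT_le_iff.2 fun j => Polynomial.natDegree_le_iff_coeff_eq_zero.2 fun i hi => ?_
    rw [← coeff_coeff_swap, Polynomial.coeff_eq_zero_of_natDegree_lt hi, Polynomial.coeff_zero]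
  · refine Polynomial.natDegree_le_iff_coeff_eq_zero.2 fun i hi => ?_
    ext j
    rw [coeff_coeff_swap, Polynomial.coeff_zero]
    exact Polynomial.coeff_eq_zero_of_natDegree_lt ((degT_le_iff.1 le_rfl j).trans_lt hi)

lemma degT_mul_le (A B : Polynomial (Polynomial k)) : degT (A * B) ≤ degT A + degT B := by
  simp only [degT_eq_natDegree_swap, map_mul]
  exact Polynomial.natDegree_mul_le

lemma degT_pow_le (A : Polynomial (Polynomial k)) (n : ℕ) : degT (A ^ n) ≤ n * degT A := by
  simp only [degT_eq_natDegree_swap, map_pow]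
  exact Polynomial.natDegree_pow_le

lemma degT_le_of_dvd {A B : Polynomial (Polynomial k)} (h : A ∣ B) (hB : B ≠ 0) :
    degT A ≤ degT B := by
  simp only [degT_eq_natDegree_swap]
  exact Polynomial.natDegree_le_of_dvd (map_dvd _ h) (by simpa using hB)

end DegT

lemma aeval_C_polynomial {k : Type*} [Field k] (f : PowerSeries k) (c : Polynomial k) :
    Polynomial.aeval f (Polynomial.C c) = (c : PowerSeries k) := by
  rw [Polynomial.aeval_C, algebraMap_polynomial_eq_coe]

/-! ### Minimal polynomials -/

/-- The minimal polynomial of an algebraic power series: an annihilator dividing all others. -/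
lemma exists_irreducible_annihilator {k : Type*} [Field k] (f : PowerSeries k)
    (hf : (annihilators f).Nonempty) :
    ∃ A ∈ annihilators f, A.natDegree ≠ 0 ∧ ∀ B, Polynomial.aeval f B = 0 → A ∣ B := by
  classical
  obtain ⟨A₁, hA₁, hfA₁⟩ := hf
  have key : ∀ A : Polynomial (Polynomial k), A ≠ 0 → Polynomial.aeval f A = 0 →
      ∃ q : Polynomial (Polynomial k), Irreducible q ∧ Polynomial.aeval f q = 0 := by
    intro A
    induction A using WfDvdMonoid.induction_on_irreducible with
    | zero => exact fun h => absurd rfl h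
    | unit u hu =>
      intro _ h
      exact absurd h (hu.map (Polynomial.aeval f)).ne_zero
    | mul a i ha hi ih =>
      intro _ h
      rw [map_mul, mul_eq_zero] at h
      rcases h with h | h
      · exact ⟨i, hi, h⟩
      · exact ih ha h
  obtain ⟨q, hq, hfq⟩ := key A₁ hA₁ hfA₁
  have hconst : ∀ c : Polynomial k, Polynomial.aeval f (Polynomial.C c) = 0 → c = 0 := by
    intro c hc
    rw [aeval_C_polynomial] at hc
    exact Polynomial.coe_eq_zero_iff.1 hc
  have hdeg : q.natDegree ≠ 0 := by
    intro h0
    rw [Polynomial.eq_C_of_natDegree_eq_zero h0] at hfq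
    have h1 := hconst _ hfq
    apply hq.ne_zero
    rw [Polynomial.eq_C_of_natDegree_eq_zero h0, h1, Polynomial.C_0]
  refine ⟨q, ⟨hq.ne_zero, hfq⟩, hdeg, fun B hB => ?_⟩
  have hprim := hq.isPrimitive hdeg
  apply hprim.dvd_of_fraction_map_dvd_fraction_map (K := FractionRing (Polynomial k))
  have hirr := (hprim.irreducible_iff_irreducible_map_fraction_map
    (K := FractionRing (Polynomial k))).1 hq
  refine (EuclideanDomain.dvd_or_coprime _ _ hirr).resolve_right ?_
  -- If q and B were coprime over k(t), clearing denominators in Bézout's identity would give a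
  -- nonzero element of k[t] vanishing at f.
  rintro ⟨a, b, hab⟩
  obtain ⟨s, hs, hsa⟩ := IsLocalization.integerNormalization_spec (nonZeroDivisors (Polynomial k)) a
  obtain ⟨t, ht, htb⟩ := IsLocalization.integerNormalization_spec (nonZeroDivisors (Polynomial k)) b
  set a' := IsLocalization.integerNormalization (nonZeroDivisors (Polynomial k)) a
  set b' := IsLocalization.integerNormalization (nonZeroDivisors (Polynomial k)) b
  have hrel : Polynomial.C t * a' * q + Polynomial.C s * b' * B = Polynomial.C (s * t) := by
    apply Polynomial.map_injective (algebraMap (Polynomial k) (FractionRing (Polynomial k)))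
      (IsFractionRing.injective _ _)
    simp only [Polynomial.map_add, Polynomial.map_mul, hsa, htb, Polynomial.map_C, map_mul]
    rw [← mul_one (Polynomial.C _ * Polynomial.C _), ← hab]
    simp only [Algebra.smul_def, Polynomial.algebraMap_apply]
    ring
  have h2 := congrArg (Polynomial.aeval f) hrel
  rw [map_add, map_mul, map_mul _ _ B, hfq, hB, mul_zero, mul_zero, add_zero] at h2
  exact mul_ne_zero (nonZeroDivisors.ne_zero hs) (nonZeroDivisors.ne_zero ht) (hconst _ h2.symm)

/-! ### Separability and the extraction identity -/

section Perfect

variable {K : Type*} [Field K] {p : ℕ} [Fact p.Prime] [CharP K p] [PerfectRing K p]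

lemma aeval_eq_sum_coe (f : PowerSeries K) {A : Polynomial (Polynomial K)} {n : ℕ}
    (hA : A.natDegree < n) :
    Polynomial.aeval f A =
      ∑ j ∈ Finset.range n, ((A.coeff j : Polynomial K) : PowerSeries K) * f ^ j := by
  rw [Polynomial.aeval_eq_sum_range' hA]
  exact Finset.sum_congr rfl fun j _ => by
    rw [Algebra.smul_def, algebraMap_polynomial_eq_coe]

/-- The minimal polynomial of an algebraic power series over a perfect field is separable. -/
lemma exists_separable_annihilator (p : ℕ) [Fact p.Prime] [CharP K p] [PerfectRing K p]
    (f : PowerSeries K) (hf : (annihilators f).Nonempty) :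
    ∃ A : Polynomial (Polynomial K), Polynomial.aeval f A = 0 ∧
      Polynomial.aeval f (Polynomial.derivative A) ≠ 0 ∧
      ∀ B ∈ annihilators f, A.natDegree ≤ B.natDegree ∧ degT A ≤ degT B := by
  obtain ⟨A, ⟨hA0, hAf⟩, hdeg, hdvd⟩ := exists_irreducible_annihilator f hf
  refine ⟨A, hAf, fun hder => ?_, fun B hB =>
    ⟨Polynomial.natDegree_le_of_dvd (hdvd B hB.2) hB.1, degT_le_of_dvd (hdvd B hB.2) hB.1⟩⟩
  have hp : p.Prime := Fact.out
  have hder0 : Polynomial.derivative A = 0 := by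
    by_contra h
    have h1 := Polynomial.natDegree_le_of_dvd (hdvd _ hder) h
    have h2 := Polynomial.natDegree_derivative_lt hdeg
    omega
  have hexp : Polynomial.expand (Polynomial K) p (Polynomial.contract p A) = A :=
    Polynomial.expand_contract p hder0 hp.ne_zero
  set C := Polynomial.contract p A with hC
  have hCA : A.natDegree = C.natDegree * p := by rw [← hexp, Polynomial.natDegree_expand]
  -- With A = C(yᵖ), applying C_r to A(f) = 0 gives a relation of degree at most deg A / p; r is
  -- chosen so that the leading coefficient of C survives, contradicting minimality.
  obtain ⟨r, hr, hr0⟩ := exists_cartierPoly_ne_zero (p := p)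
    (Polynomial.leadingCoeff_ne_zero.2 (fun h : C = 0 => hA0 (by rw [← hexp, h, map_zero])))
  let D : Polynomial (Polynomial K) :=
    ∑ j ∈ Finset.range (C.natDegree + 1), Polynomial.monomial j (cartierPoly p r (C.coeff j))
  have hD0 : D ≠ 0 := by
    intro h
    apply hr0
    have h1 := congrArg (Polynomial.coeff · C.natDegree) h
    simpa [D, Polynomial.finsetSum_coeff, Polynomial.coeff_monomial] using h1
  have hDdeg : D.natDegree ≤ C.natDegree :=
    Polynomial.natDegree_sum_le_of_forall_le _ _ fun j hj =>
      (Polynomial.natDegree_monomial_le _).trans (Nat.lt_succ_iff.1 (Finset.mem_range.1 hj))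
  have hDf : Polynomial.aeval f D = 0 := by
    have h1 : Polynomial.aeval f A = ∑ j ∈ Finset.range (C.natDegree + 1),
        ((C.coeff j : Polynomial K) : PowerSeries K) * (f ^ j) ^ p := by
      rw [← hexp, Polynomial.expand_aeval, aeval_eq_sum_coe _ (Nat.lt_succ_self _)]
      exact Finset.sum_congr rfl fun j _ => by rw [← pow_mul, ← pow_mul, mul_comm p j]
    have h2 := congrArg (cartier p r) (h1.symm.trans hAf)
    rw [map_zero, map_sum] at h2
    rw [← h2, map_sum]
    refine Finset.sum_congr rfl fun j _ => ?_
    rw [cartier_mul_pow hr, Polynomial.aeval_monomial, algebraMap_polynomial_eq_coe,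
      coe_cartierPoly]
  have h3 := Polynomial.natDegree_le_of_dvd (hdvd D hDf) hD0
  have h4 : C.natDegree ≠ 0 := fun h => hdeg (by rw [hCA, h, zero_mul])
  have h5 : C.natDegree * 2 ≤ C.natDegree * p := Nat.mul_le_mul_left _ hp.two_le
  omega

/-- By Lucas, only the last base-p digit of n matters, and it must be p - 1. -/
lemma natCast_choose_sub_one (R : Type*) [CommRing R] [CharP R p] (n : ℕ) :
    ((n.choose (p - 1) : ℕ) : R) = if n % p = p - 1 then 1 else 0 := by
  have hp : p.Prime := Fact.out
  have h := Choose.choose_modEq_choose_mod_mul_choose_div_nat (n := n) (k := p - 1) (p := p)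
  have h1 : (p - 1) % p = p - 1 := Nat.mod_eq_of_lt (Nat.sub_lt hp.pos one_pos)
  have h2 : (p - 1) / p = 0 := Nat.div_eq_of_lt (Nat.sub_lt hp.pos one_pos)
  rw [h1, h2, Nat.choose_zero_right, mul_one] at h
  rw [(CharP.natCast_eq_natCast R p).2 h]
  have h3 := Nat.mod_lt n hp.pos
  split_ifs with h4
  · rw [h4, Nat.choose_self, Nat.cast_one]
  · rw [Nat.choose_eq_zero_of_lt (by omega), Nat.cast_zero]

/-- Over a ring of characteristic `p`, at a root `x` of `A`, the part of `P A ^ (p - 1)` of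
exponents congruent to `p - 1` takes the value `P(x) A'(x) ^ (p - 1)`. -/
lemma sum_coeff_mul_pow_eq {R : Type*} [CommRing R] [CharP R p] {A P : Polynomial R} {x : R}
    (hA : A.eval x = 0) {n : ℕ} (hn : (P * A ^ (p - 1)).natDegree < p * n) :
    ∑ e ∈ Finset.range n, (P * A ^ (p - 1)).coeff (p * e + (p - 1)) * (x ^ e) ^ p =
      P.eval x * (Polynomial.derivative A).eval x ^ (p - 1) := by
  have hp : p.Prime := Fact.out
  set G := P * A ^ (p - 1) with hG
  -- Since A(x) = 0, the Taylor expansion of A at x is X·B with B(0) = A'(x); so that of G is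
  -- X^(p-1) times a series with constant term P(x) A'(x)^(p-1).
  have h1 : (Polynomial.hasseDeriv (p - 1) G).eval x =
      P.eval x * (Polynomial.derivative A).eval x ^ (p - 1) := by
    rw [← Polynomial.taylor_coeff, hG, Polynomial.taylor_mul, Polynomial.taylor_pow]
    obtain ⟨B, hB⟩ : Polynomial.X ∣ Polynomial.taylor x A := by
      rw [Polynomial.X_dvd_iff, Polynomial.taylor_coeff_zero, hA]
    rw [← Polynomial.taylor_coeff_zero, ← Polynomial.taylor_coeff_one, hB, mul_pow,
      mul_left_comm, Polynomial.coeff_X_pow_mul', if_pos le_rfl, Nat.sub_self,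
      Polynomial.mul_coeff_zero]
    congr 1
    rw [Polynomial.coeff_X_mul, Polynomial.coeff_zero_eq_eval_zero, Polynomial.eval_pow,
      ← Polynomial.coeff_zero_eq_eval_zero]
  rw [← h1, Polynomial.hasseDeriv_apply, Polynomial.sum_over_range' _ _ (p * n) hn]
  swap
  · simp
  rw [Polynomial.eval_finsetSum]
  have h2 : ∀ i ∈ Finset.range (p * n), i ∉ (Finset.range n).image (fun e => p * e + (p - 1)) →
      (Polynomial.monomial (i - (p - 1)) ((i.choose (p - 1) : R) * G.coeff i)).eval x = 0 := by
    intro i hi hi'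
    rw [natCast_choose_sub_one (p := p), if_neg]
    · simp
    intro h
    apply hi'
    refine Finset.mem_image.2 ⟨i / p, Finset.mem_range.2 ?_, ?_⟩
    · exact Nat.div_lt_of_lt_mul (Finset.mem_range.1 hi)
    · show p * (i / p) + (p - 1) = i
      rw [← h, Nat.div_add_mod]
  rw [← Finset.sum_subset _ h2, Finset.sum_image]
  · refine Finset.sum_congr rfl fun e _ => ?_
    rw [natCast_choose_sub_one (p := p), if_pos, Polynomial.eval_monomial, one_mul,
      Nat.add_sub_cancel, ← pow_mul, mul_comm e p]
    rw [Nat.mul_add_mod, Nat.mod_eq_of_lt (Nat.sub_lt hp.pos one_pos)]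
  · intro a _ b _ hab
    exact Nat.eq_of_mul_eq_mul_left hp.pos (Nat.add_right_cancel hab)
  · intro i hi
    obtain ⟨e, he, rfl⟩ := Finset.mem_image.1 hi
    have h3 : p * (e + 1) ≤ p * n := Nat.mul_le_mul_left _ (Finset.mem_range.1 he)
    have h4 := hp.pos
    rw [mul_add, mul_one] at h3
    exact Finset.mem_range.2 (by omega)

end Perfect

/-! ### A small stable space containing an algebraic series -/

section SectionSpace

variable {K : Type*} [Field K]

/-- The values at `f` of the polynomials of degree at most `d` in `y` and at most `h` in `t`. -/
def valueSpace (f : PowerSeries K) (d h : ℕ) : Submodule K (PowerSeries K) :=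
  Submodule.span K (Set.range fun ij : Fin (d + 1) × Fin (h + 1) =>
    PowerSeries.X ^ (ij.2 : ℕ) * f ^ (ij.1 : ℕ))

instance (f : PowerSeries K) (d h : ℕ) : FiniteDimensional K (valueSpace f d h) :=
  FiniteDimensional.span_of_finite K (Set.finite_range _)

lemma finrank_valueSpace_le (f : PowerSeries K) (d h : ℕ) :
    Module.finrank K (valueSpace f d h) ≤ (d + 1) * (h + 1) := by
  refine (finrank_range_le_card (R := K) fun ij : Fin (d + 1) × Fin (h + 1) =>
    PowerSeries.X ^ (ij.2 : ℕ) * f ^ (ij.1 : ℕ)).trans ?_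
  simp

lemma sum_coe_mul_pow_mem_valueSpace (f : PowerSeries K) {d h : ℕ} (c : ℕ → Polynomial K)
    (hc : ∀ j, (c j).natDegree ≤ h) :
    ∑ j ∈ Finset.range (d + 1), (c j : PowerSeries K) * f ^ j ∈ valueSpace f d h := by
  refine Submodule.sum_mem _ fun j hj => ?_
  have h1 : (c j : PowerSeries K) =
      ∑ i ∈ Finset.range (h + 1), (c j).coeff i • PowerSeries.X ^ i := by
    conv_lhs => rw [(c j).as_sum_range_C_mul_X_pow' (Nat.lt_succ_iff.2 (hc j))]
    rw [← Polynomial.coeToPowerSeries.ringHom_apply, map_sum]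
    refine Finset.sum_congr rfl fun i _ => ?_
    simp [PowerSeries.smul_eq_C_mul]
  rw [h1, Finset.sum_mul]
  refine Submodule.sum_mem _ fun i hi => ?_
  rw [smul_mul_assoc]
  exact Submodule.smul_mem _ _ (Submodule.subset_span
    ⟨(⟨j, Finset.mem_range.1 hj⟩, ⟨i, Finset.mem_range.1 hi⟩), rfl⟩)

lemma aeval_mem_valueSpace (f : PowerSeries K) {d h : ℕ} {P : Polynomial (Polynomial K)}
    (hd : P.natDegree ≤ d) (hh : degT P ≤ h) :
    Polynomial.aeval f P ∈ valueSpace f d h := by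
  rw [aeval_eq_sum_coe f (Nat.lt_succ_iff.2 hd)]
  exact sum_coe_mul_pow_mem_valueSpace f _ (degT_le_iff.1 hh)

lemma exists_aeval_eq_of_mem_valueSpace {f : PowerSeries K} {d h : ℕ} {x : PowerSeries K}
    (hx : x ∈ valueSpace f d h) :
    ∃ P : Polynomial (Polynomial K), P.natDegree ≤ d ∧ degT P ≤ h ∧
      Polynomial.aeval f P = x := by
  simp only [degT_le_iff]
  induction hx using Submodule.span_induction with
  | mem x hx =>
    obtain ⟨⟨i, j⟩, rfl⟩ := hx
    refine ⟨Polynomial.monomial i (Polynomial.X ^ (j : ℕ)),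
      (Polynomial.natDegree_monomial_le _).trans (Nat.lt_succ_iff.1 i.2), fun l => ?_, ?_⟩
    · rw [Polynomial.coeff_monomial]
      split_ifs
      · rw [Polynomial.natDegree_X_pow]
        exact Nat.lt_succ_iff.1 j.2
      · simp
    · rw [Polynomial.aeval_monomial, algebraMap_polynomial_eq_coe, Polynomial.coe_pow,
        Polynomial.coe_X]
  | zero => exact ⟨0, by simp, by simp, by simp⟩
  | add x y _ _ ihx ihy =>
    obtain ⟨P, hP, hP', rfl⟩ := ihx
    obtain ⟨Q, hQ, hQ', rfl⟩ := ihy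
    refine ⟨P + Q, Polynomial.natDegree_add_le_of_degree_le hP hQ, fun j => ?_, map_add _ _ _⟩
    rw [Polynomial.coeff_add]
    exact Polynomial.natDegree_add_le_of_degree_le (hP' j) (hQ' j)
  | smul c x _ ih =>
    obtain ⟨P, hP, hP', rfl⟩ := ih
    refine ⟨Polynomial.C (Polynomial.C c) * P, (Polynomial.natDegree_C_mul_le _ _).trans hP,
      fun j => ?_, ?_⟩
    · rw [Polynomial.coeff_C_mul]
      exact (Polynomial.natDegree_C_mul_le _ _).trans (hP' j)
    · rw [map_mul, aeval_C_polynomial, Polynomial.coe_C, PowerSeries.smul_eq_C_mul]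

/-- An algebraic power series over a perfect field lies in a small space stable under the section
operators. -/
theorem exists_stable_submodule (p : ℕ) [Fact p.Prime] [CharP K p] [PerfectRing K p]
    {f : PowerSeries K} {d h : ℕ} (hd : ∃ B ∈ annihilators f, B.natDegree ≤ d)
    (hh : ∃ B ∈ annihilators f, degT B ≤ h) :
    ∃ W : Submodule K (PowerSeries K), FiniteDimensional K W ∧
      Module.finrank K W ≤ (d + 1) * (h + 1) ∧ f ∈ W ∧
      ∀ r < p, ∀ w ∈ W, cartier p r w ∈ W := by
  have hp : p.Prime := Fact.out
  have : CharP (PowerSeries K) p := charP_of_injective_algebraMap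
    (algebraMap K (PowerSeries K)).injective p
  obtain ⟨B₁, hB₁, hB₁d⟩ := hd
  obtain ⟨B₂, hB₂, hB₂h⟩ := hh
  obtain ⟨A, hAf, hder, hmin⟩ := exists_separable_annihilator p f ⟨B₁, hB₁⟩
  have hAd : A.natDegree ≤ d := (hmin B₁ hB₁).1.trans hB₁d
  have hAh : degT A ≤ h := (hmin B₂ hB₂).2.trans hB₂h
  set δ := Polynomial.aeval f (Polynomial.derivative A) with hδ
  -- Multiplication by δ = A'(f) ≠ 0 embeds W in the value space, which bounds its dimension.
  let W := (valueSpace f d h).comap (LinearMap.mulLeft K δ)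
  let mulDer : W →ₗ[K] valueSpace f d h := (LinearMap.mulLeft K δ).restrict fun _ hw => hw
  have hmulDer : Function.Injective mulDer := by
    intro x y hxy
    have h1 : δ * (x : PowerSeries K) = δ * y := congrArg Subtype.val hxy
    exact Subtype.ext (mul_left_cancel₀ hder h1)
  refine ⟨W, FiniteDimensional.of_injective mulDer hmulDer,
    (LinearMap.finrank_le_finrank_of_injective hmulDer).trans (finrank_valueSpace_le f d h), ?_, ?_⟩
  · have h1 : Polynomial.aeval f (Polynomial.derivative A * Polynomial.X) = δ * f := by
      rw [map_mul, Polynomial.aeval_X]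
    show δ * f ∈ valueSpace f d h
    rw [← h1]
    refine aeval_mem_valueSpace f ?_ (degT_le_iff.2 fun j => ?_)
    · by_cases h0 : A.natDegree = 0
      · rw [Polynomial.derivative_of_natDegree_zero h0, zero_mul]
        simp
      · have h2 := Polynomial.natDegree_derivative_lt h0
        have h3 := Polynomial.natDegree_mul_le (p := Polynomial.derivative A)
          (q := Polynomial.X)
        rw [Polynomial.natDegree_X] at h3
        omega
    · cases j with
      | zero => simp
      | succ j =>
        rw [Polynomial.coeff_mul_X, Polynomial.coeff_derivative]
        refine Polynomial.natDegree_mul_le.trans ?_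
        have h2 : ((j : Polynomial K) + 1).natDegree = 0 := by
          exact_mod_cast Polynomial.natDegree_natCast (R := K) (j + 1)
        rw [h2, add_zero]
        exact degT_le_iff.1 hAh _
  · intro r hr w hw
    obtain ⟨P, hPd, hPh, hPw⟩ := exists_aeval_eq_of_mem_valueSpace (show δ * w ∈ _ from hw)
    set G := P * A ^ (p - 1) with hG
    have hp1 : p - 1 + 1 = p := Nat.sub_add_cancel hp.one_le
    -- deg G ≤ d + (p-1)d = pd, so the extracted exponents pe + p - 1 have e ≤ d.
    have hGd : G.natDegree < p * (d + 1) := by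
      have h1 : (A ^ (p - 1)).natDegree ≤ (p - 1) * d :=
        Polynomial.natDegree_pow_le.trans (Nat.mul_le_mul_left _ hAd)
      have h2 := Polynomial.natDegree_mul_le (p := P) (q := A ^ (p - 1))
      rw [← hG] at h2
      have h3 : (p - 1) * d + d = p * d := by rw [← Nat.succ_mul, Nat.succ_eq_add_one, hp1]
      have h4 := hp.pos
      rw [mul_add, mul_one]
      omega
    have hGh : degT G ≤ p * h := by
      have h1 : degT (A ^ (p - 1)) ≤ (p - 1) * h :=
        (degT_pow_le _ _).trans (Nat.mul_le_mul_left _ hAh)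
      have h2 := degT_mul_le P (A ^ (p - 1))
      rw [← hG] at h2
      have h3 : (p - 1) * h + h = p * h := by rw [← Nat.succ_mul, Nat.succ_eq_add_one, hp1]
      omega
    have hmap : ∀ Q : Polynomial (Polynomial K), (Q.map (algebraMap _ (PowerSeries K))).eval f =
        Polynomial.aeval f Q := fun Q => Polynomial.eval_map_algebraMap Q f
    have hsum := sum_coeff_mul_pow_eq (p := p) (n := d + 1)
      (A := A.map (algebraMap _ (PowerSeries K))) (P := P.map (algebraMap _ (PowerSeries K)))
      (x := f) (by rw [hmap, hAf]) (by
        rw [← Polynomial.map_pow, ← Polynomial.map_mul]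
        exact Polynomial.natDegree_map_le.trans_lt hGd)
    -- Here P(f) δ^(p-1) = w δᵖ, so applying C_r leaves δ C_r(w).
    rw [← Polynomial.map_pow, ← Polynomial.map_mul, Polynomial.derivative_map, hmap, hmap, hPw,
      ← hδ, mul_assoc, mul_left_comm, ← pow_succ', hp1] at hsum
    have h1 := congrArg (cartier p r) hsum
    rw [cartier_mul_pow hr, map_sum] at h1
    show δ * cartier p r w ∈ valueSpace f d h
    rw [mul_comm, ← h1]
    have h2 := sum_coe_mul_pow_mem_valueSpace f (d := d) (h := h)
      (fun e => cartierPoly p r (G.coeff (p * e + (p - 1)))) fun e => by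
        refine (natDegree_cartierPoly_le _ _).trans ?_
        exact Nat.div_le_of_le_mul (degT_le_iff.1 hGh _)
    convert h2 using 2 with e he
    rw [cartier_mul_pow hr, Polynomial.coeff_map, algebraMap_polynomial_eq_coe, coe_cartierPoly]

end SectionSpace

/-! ### Sections of Lamperti products -/

section Lamperti

variable {K : Type*} [Field K]

/-- The Lamperti product as a bilinear map. -/
def lampertiBilin (α β γ : K) : PowerSeries K →ₗ[K] PowerSeries K →ₗ[K] PowerSeries K :=
  LinearMap.mk₂ K (lamperti α β γ)
    (fun f f' g => by
      ext i
      simp only [lamperti, PowerSeries.coeff_mk, map_add, mul_add, add_mul,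
        Finset.sum_add_distrib])
    (fun c f g => by
      ext i
      simp only [lamperti, PowerSeries.coeff_mk, map_smul, smul_eq_mul, Finset.mul_sum]
      exact Finset.sum_congr rfl fun _ _ => by ring)
    (fun f g g' => by
      ext i
      simp only [lamperti, PowerSeries.coeff_mk, map_add, mul_add, Finset.sum_add_distrib])
    (fun c f g => by
      ext i
      simp only [lamperti, PowerSeries.coeff_mk, map_smul, smul_eq_mul, Finset.mul_sum]
      exact Finset.sum_congr rfl fun _ _ => by ring)

/-- The linear functional on polynomials in `x, y` mapping `xᵃ yᵇ` to the product of the `a`-th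
coefficient of `f` and the `b`-th coefficient of `g`. -/
def pairing (f g : PowerSeries K) : Polynomial (Polynomial K) →+ K where
  toFun P := P.sum fun a c => c.sum fun b e => e * PowerSeries.coeff a f * PowerSeries.coeff b g
  map_zero' := by simp
  map_add' P Q := by
    rw [Polynomial.sum_add_index]
    · simp
    · intro a c c'
      rw [Polynomial.sum_add_index]
      · simp
      · intro b e e'
        ring

lemma pairing_monomial (f g : PowerSeries K) (a b : ℕ) (c : K) :
    pairing f g (Polynomial.monomial a (Polynomial.monomial b c)) =
      c * PowerSeries.coeff a f * PowerSeries.coeff b g := by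
  change ((Polynomial.monomial a (Polynomial.monomial b c)).sum fun a c =>
    c.sum fun b e => e * PowerSeries.coeff a f * PowerSeries.coeff b g) = _
  rw [Polynomial.sum_monomial_index, Polynomial.sum_monomial_index] <;> simp

/-- The polynomial `α x + γ x y + β y`. -/
def lampertiPoly (α β γ : K) : Polynomial (Polynomial K) :=
  Polynomial.monomial 1 (Polynomial.monomial 0 α) +
    Polynomial.monomial 1 (Polynomial.monomial 1 γ) +
    Polynomial.monomial 0 (Polynomial.monomial 1 β)

lemma lampertiPoly_pow (α β γ : K) (i : ℕ) :
    lampertiPoly α β γ ^ i = ∑ x ∈ Finset.Nat.antidiagonalTuple 3 i,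
      Polynomial.monomial (x 0 + x 1) (Polynomial.monomial (x 2 + x 1)
        (((i ! / ((x 0)! * (x 1)! * (x 2)!) : ℕ) : K) * α ^ x 0 * β ^ x 2 * γ ^ x 1)) := by
  have h1 : lampertiPoly α β γ = ∑ s : Fin 3, (![Polynomial.monomial 1 (Polynomial.monomial 0 α),
      Polynomial.monomial 1 (Polynomial.monomial 1 γ),
      Polynomial.monomial 0 (Polynomial.monomial 1 β)] : Fin 3 → Polynomial (Polynomial K)) s := by
    simp [Fin.sum_univ_three, lampertiPoly]
  have h2 : (Finset.univ : Finset (Fin 3)).piAntidiag i = Finset.Nat.antidiagonalTuple 3 i := by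
    ext x
    simp [Finset.mem_piAntidiag, Finset.Nat.mem_antidiagonalTuple]
  rw [h1, Finset.sum_pow_eq_sum_piAntidiag, h2]
  refine Finset.sum_congr rfl fun x hx => ?_
  rw [Finset.Nat.mem_antidiagonalTuple] at hx
  have h3 : Nat.multinomial Finset.univ x = i ! / ((x 0)! * (x 1)! * (x 2)!) := by
    rw [Nat.multinomial, hx, Fin.prod_univ_three]
  rw [h3, Fin.prod_univ_three, ← Polynomial.C_eq_natCast, ← Polynomial.C_eq_natCast]
  simp only [Matrix.cons_val_zero, Matrix.cons_val_one, Matrix.cons_val, Polynomial.monomial_pow,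
    Polynomial.monomial_mul_monomial, Polynomial.C_mul_monomial, one_mul, zero_mul, zero_add,
    add_zero]
  congr 2
  · rw [add_comm]
  · ring

lemma coeff_lamperti (α β γ : K) (f g : PowerSeries K) (i : ℕ) :
    PowerSeries.coeff i (lamperti α β γ f g) = pairing f g (lampertiPoly α β γ ^ i) := by
  rw [lampertiPoly_pow, map_sum, lamperti, PowerSeries.coeff_mk]
  exact Finset.sum_congr rfl fun x _ => (pairing_monomial _ _ _ _ _).symm

variable {p : ℕ} [Fact p.Prime] [CharP K p] [PerfectRing K p]

/-- By additivity of Frobenius it suffices to take Q a monomial xᵃyᵇ up to scalar; then the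
coefficients at pa + u and pb + v are p-th powers of coefficients of sections. -/
lemma pairing_pow_mul_monomial (f g : PowerSeries K) (Q : Polynomial (Polynomial K)) (u v : ℕ)
    (c : K) :
    pairing f g (Q ^ p * Polynomial.monomial u (Polynomial.monomial v c)) =
      c * pairing (cartier p u f) (cartier p v g) Q ^ p := by
  induction Q using Polynomial.induction_on' with
  | add P Q hP hQ => rw [add_pow_char, add_mul, map_add, hP, hQ, map_add, add_pow_char, mul_add]
  | monomial a q =>
    induction q using Polynomial.induction_on' with
    | add P Q hP hQ =>
      rw [map_add, add_pow_char, add_mul, map_add, hP, hQ, map_add, add_pow_char, mul_add]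
    | monomial b e =>
      rw [Polynomial.monomial_pow, Polynomial.monomial_pow, Polynomial.monomial_mul_monomial,
        Polynomial.monomial_mul_monomial, pairing_monomial, pairing_monomial, coeff_cartier,
        coeff_cartier, mul_pow, mul_pow, frobeniusEquiv_symm_pow_p, frobeniusEquiv_symm_pow_p,
        mul_comm a, mul_comm b]
      ring

/-- Write L^(pn+r) = (Lⁿ)ᵖ Lʳ for L = `lampertiPoly α β γ` and expand only Lʳ. The p-th root
restores Lⁿ, so the parameters are unchanged. -/
lemma cartier_lamperti (α β γ : K) (f g : PowerSeries K) (r : ℕ) :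
    cartier p r (lamperti α β γ f g) = ∑ x ∈ Finset.Nat.antidiagonalTuple 3 r,
      (frobeniusEquiv K p).symm
          (((r ! / ((x 0)! * (x 1)! * (x 2)!) : ℕ) : K) * α ^ x 0 * β ^ x 2 * γ ^ x 1) •
        lamperti α β γ (cartier p (x 0 + x 1) f) (cartier p (x 2 + x 1) g) := by
  ext n
  rw [coeff_cartier, coeff_lamperti, mul_comm p n, pow_add, pow_mul, lampertiPoly_pow _ _ _ r,
    Finset.mul_sum, map_sum, map_sum, map_sum]
  refine Finset.sum_congr rfl fun x _ => ?_
  rw [pairing_pow_mul_monomial, map_mul, frobeniusEquiv_symm_pow, map_smul, coeff_lamperti,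
    smul_eq_mul]

lemma cartier_mem_map₂_lamperti (α β γ : K) {W W' : Submodule K (PowerSeries K)}
    (hW : ∀ r < p, ∀ w ∈ W, cartier p r w ∈ W) (hW' : ∀ r < p, ∀ w ∈ W', cartier p r w ∈ W') :
    ∀ r < p, ∀ v ∈ Submodule.map₂ (lampertiBilin α β γ) W W',
      cartier p r v ∈ Submodule.map₂ (lampertiBilin α β γ) W W' := by
  intro r hr v hv
  rw [Submodule.map₂_eq_span_image2] at hv
  induction hv using Submodule.span_induction with
  | mem v hv =>
    obtain ⟨f, hf, g, hg, rfl⟩ := hv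
    show cartier p r (lamperti α β γ f g) ∈ _
    rw [cartier_lamperti]
    refine Submodule.sum_mem _ fun x hx => Submodule.smul_mem _ _ ?_
    rw [Finset.Nat.mem_antidiagonalTuple, Fin.sum_univ_three] at hx
    -- Both section indices are at most x 0 + x 1 + x 2 = r < p.
    exact Submodule.apply_mem_map₂ _ (hW _ (by omega) _ hf) (hW' _ (by omega) _ hg)
  | zero => simp
  | add x y _ _ hx hy =>
    rw [map_add]
    exact Submodule.add_mem _ hx hy
  | smul c x _ hx =>
    rw [cartier_smul]
    exact Submodule.smul_mem _ _ hx

end Lamperti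

lemma eq_span_range_finBasis {K M : Type*} [Field K] [AddCommGroup M] [Module K M]
    (U : Submodule K M) [FiniteDimensional K U] :
    U = Submodule.span K (Set.range fun i => (Module.finBasis K U i : M)) := by
  have h := congrArg (Submodule.map U.subtype) (Module.finBasis K U).span_eq
  rw [Submodule.map_top, Submodule.range_subtype, Submodule.map_span, ← Set.range_comp] at h
  exact h.symm

lemma finrank_map₂_le {K M M' M'' : Type*} [Field K] [AddCommGroup M] [Module K M]
    [AddCommGroup M'] [Module K M'] [AddCommGroup M''] [Module K M'']
    (B : M →ₗ[K] M' →ₗ[K] M'') (W : Submodule K M) (W' : Submodule K M')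
    [FiniteDimensional K W] [FiniteDimensional K W'] :
    FiniteDimensional K (Submodule.map₂ B W W') ∧
      Module.finrank K (Submodule.map₂ B W W') ≤ Module.finrank K W * Module.finrank K W' := by
  have h : Submodule.map₂ B W W' = Submodule.span K (Set.range
      fun ij : Fin (Module.finrank K W) × Fin (Module.finrank K W') =>
        B (Module.finBasis K W ij.1) (Module.finBasis K W' ij.2)) := by
    conv_lhs => rw [eq_span_range_finBasis W, eq_span_range_finBasis W',
      Submodule.map₂_span_span, Set.image2_range]
  rw [h]
  refine ⟨FiniteDimensional.span_of_finite K (Set.finite_range _), ?_⟩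
  refine (finrank_range_le_card (R := K) _).trans ?_
  simp

lemma isAlg_iff {k : Type*} [Field k] (f : PowerSeries k) :
    IsAlg f ↔ (annihilators f).Nonempty := by
  have : IsScalarTower (Polynomial k) (PowerSeries k) (LaurentSeries k) :=
    IsScalarTower.of_algebraMap_eq fun _ => rfl
  rw [IsAlg, ← IsFractionRing.isAlgebraic_iff (Polynomial k) (RatFunc k) (LaurentSeries k),
    isAlgebraic_algebraMap_iff (FaithfulSMul.algebraMap_injective _ _)]
  rfl

/-! ### Extension and descent of scalars -/

section Descent

variable {k K : Type*} [Field k] [Field K] [Algebra k K]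

/-- A `k`-linear functional on `K`, applied to the coefficients of a power series. -/
def mapFunctional (l : K →ₗ[k] k) : PowerSeries K →+ PowerSeries k where
  toFun F := PowerSeries.mk fun n => l (PowerSeries.coeff n F)
  map_zero' := by ext; simp
  map_add' F G := by ext; simp

@[simp] lemma coeff_mapFunctional (l : K →ₗ[k] k) (F : PowerSeries K) (n : ℕ) :
    PowerSeries.coeff n (mapFunctional l F) = l (PowerSeries.coeff n F) := by
  simp [mapFunctional]

lemma mapFunctional_mul_map (l : K →ₗ[k] k) (F : PowerSeries K) (g : PowerSeries k) :
    mapFunctional l (F * PowerSeries.map (algebraMap k K) g) = mapFunctional l F * g := by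
  ext n
  rw [coeff_mapFunctional, PowerSeries.coeff_mul, PowerSeries.coeff_mul, map_sum]
  refine Finset.sum_congr rfl fun x _ => ?_
  rw [PowerSeries.coeff_map, mul_comm, ← Algebra.smul_def, map_smul, coeff_mapFunctional,
    smul_eq_mul, mul_comm]

lemma exists_coe_eq_mapFunctional (l : K →ₗ[k] k) (c : Polynomial K) :
    ∃ c' : Polynomial k, (c' : PowerSeries k) = mapFunctional l (c : PowerSeries K) := by
  refine ⟨PowerSeries.trunc (c.natDegree + 1) (mapFunctional l (c : PowerSeries K)), ?_⟩
  ext n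
  rw [Polynomial.coeff_coe, PowerSeries.coeff_trunc]
  split_ifs with h
  · rfl
  · rw [coeff_mapFunctional, Polynomial.coeff_coe,
      Polynomial.coeff_eq_zero_of_natDegree_lt (by omega), map_zero]

/-- The degree of an algebraic power series does not drop under extension of scalars. -/
lemma exists_annihilator_of_map {f : PowerSeries k} {B : Polynomial (Polynomial K)}
    (hB : B ∈ annihilators (PowerSeries.map (algebraMap k K) f)) :
    ∃ B' ∈ annihilators f, B'.natDegree ≤ B.natDegree := by
  obtain ⟨hB0, hBf⟩ := hB
  obtain ⟨j₀, hj₀⟩ : ∃ j, B.coeff j ≠ 0 := by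
    by_contra! h
    exact hB0 (Polynomial.ext h)
  obtain ⟨i₀, hi₀⟩ : ∃ i, (B.coeff j₀).coeff i ≠ 0 := by
    by_contra! h
    exact hj₀ (Polynomial.ext h)
  -- A functional nonzero on one coefficient of B keeps the descended relation nonzero; it commutes
  -- with multiplication by powers of f, whose coefficients lie in k.
  obtain ⟨l, hl⟩ : ∃ l : K →ₗ[k] k, l ((B.coeff j₀).coeff i₀) ≠ 0 := by
    by_contra! h
    exact hi₀ ((Module.forall_dual_apply_eq_zero_iff k _).1 h)
  choose c hc using fun j => exists_coe_eq_mapFunctional l (B.coeff j)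
  refine ⟨∑ j ∈ Finset.range (B.natDegree + 1), Polynomial.monomial j (c j), ⟨?_, ?_⟩, ?_⟩
  · intro h
    have hj : j₀ < B.natDegree + 1 := Nat.lt_succ_iff.2 (Polynomial.le_natDegree_of_ne_zero hj₀)
    have h1 := congrArg (Polynomial.coeff · j₀) h
    simp only [Polynomial.finsetSum_coeff, Polynomial.coeff_monomial, Finset.sum_ite_eq',
      Finset.mem_range, if_pos hj, Polynomial.coeff_zero] at h1
    have h2 := congrArg (PowerSeries.coeff i₀) (hc j₀)
    rw [h1, coeff_mapFunctional, Polynomial.coeff_coe, Polynomial.coeff_coe,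
      Polynomial.coeff_zero] at h2
    exact hl h2.symm
  · rw [aeval_eq_sum_coe _ (Nat.lt_succ_self _)] at hBf
    have h1 := congrArg (mapFunctional l) hBf
    rw [map_zero, map_sum] at h1
    rw [← h1, map_sum]
    refine Finset.sum_congr rfl fun j _ => ?_
    rw [Polynomial.aeval_monomial, algebraMap_polynomial_eq_coe, hc, ← map_pow,
      mapFunctional_mul_map]
  · exact Polynomial.natDegree_sum_le_of_forall_le _ _ fun j hj =>
      (Polynomial.natDegree_monomial_le _).trans (Nat.lt_succ_iff.1 (Finset.mem_range.1 hj))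

variable (K) in
lemma map_mem_annihilators {f : PowerSeries k} {B : Polynomial (Polynomial k)}
    (hB : B ∈ annihilators f) :
    B.map (Polynomial.mapRingHom (algebraMap k K)) ∈
        annihilators (PowerSeries.map (algebraMap k K) f) ∧
      (B.map (Polynomial.mapRingHom (algebraMap k K))).natDegree ≤ B.natDegree ∧
      degT (B.map (Polynomial.mapRingHom (algebraMap k K))) ≤ degT B := by
  refine ⟨⟨?_, ?_⟩, Polynomial.natDegree_map_le, degT_le_iff.2 fun j => ?_⟩
  · rw [Polynomial.map_ne_zero_iff (Polynomial.map_injective _ (algebraMap k K).injective)]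
    exact hB.1
  · rw [aeval_eq_sum_coe _ (Nat.lt_succ_iff.2 Polynomial.natDegree_map_le)]
    have h1 := hB.2
    rw [aeval_eq_sum_coe _ (Nat.lt_succ_self _)] at h1
    have h2 := congrArg (PowerSeries.map (algebraMap k K)) h1
    rw [map_zero, map_sum] at h2
    rw [← h2]
    refine Finset.sum_congr rfl fun j _ => ?_
    rw [map_mul, map_pow, Polynomial.coeff_map, Polynomial.coe_mapRingHom,
      Polynomial.polynomial_map_coe]
  · rw [Polynomial.coeff_map, Polynomial.coe_mapRingHom]
    exact Polynomial.natDegree_map_le.trans (degT_le_iff.1 le_rfl j)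

lemma map_lamperti (α β γ : k) (f g : PowerSeries k) :
    PowerSeries.map (algebraMap k K) (lamperti α β γ f g) =
      lamperti (algebraMap k K α) (algebraMap k K β) (algebraMap k K γ)
        (PowerSeries.map (algebraMap k K) f) (PowerSeries.map (algebraMap k K) g) := by
  ext i
  simp only [lamperti, PowerSeries.coeff_map, PowerSeries.coeff_mk, map_sum, map_mul, map_pow,
    map_natCast]

end Descent

/-! ### The degree bound and its special cases -/

theorem isAlg_lamperti_and_degree_le {k : Type*} [Field k] {p : ℕ} [Fact p.Prime] [CharP k p]
    {f g : PowerSeries k} (hf : IsAlg f) (hg : IsAlg g) (α β γ : k) :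
    IsAlg (lamperti α β γ f g) ∧ degree (lamperti α β γ f g) ≤
      p ^ ((degree f + 1) * (degree g + 1) * (height f + 1) * (height g + 1)) - 1 := by
  -- The closure provides the p-th roots that the section operators need.
  let K := AlgebraicClosure k
  have : CharP K p := charP_of_injective_algebraMap (algebraMap k K).injective p
  have hstable : ∀ {u : PowerSeries k}, IsAlg u → ∃ W : Submodule K (PowerSeries K),
      FiniteDimensional K W ∧ Module.finrank K W ≤ (degree u + 1) * (height u + 1) ∧
      PowerSeries.map (algebraMap k K) u ∈ W ∧ ∀ r < p, ∀ w ∈ W, cartier p r w ∈ W := by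
    intro u hu
    have hne := (isAlg_iff u).1 hu
    obtain ⟨B₁, hB₁, hd⟩ := Nat.sInf_mem (hne.image Polynomial.natDegree)
    obtain ⟨B₂, hB₂, hh⟩ := Nat.sInf_mem (hne.image degT)
    obtain ⟨h1, h2, -⟩ := map_mem_annihilators K hB₁
    obtain ⟨h3, -, h4⟩ := map_mem_annihilators K hB₂
    exact exists_stable_submodule p ⟨_, h1, h2.trans hd.le⟩ ⟨_, h3, h4.trans hh.le⟩
  obtain ⟨W, _, hWN, hfW, hW⟩ := hstable hf
  obtain ⟨W', _, hWN', hgW', hW'⟩ := hstable hg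
  obtain ⟨_, hrank⟩ := finrank_map₂_le
    (lampertiBilin (algebraMap k K α) (algebraMap k K β) (algebraMap k K γ)) W W'
  have hN : Module.finrank K (Submodule.map₂
      (lampertiBilin (algebraMap k K α) (algebraMap k K β) (algebraMap k K γ)) W W') ≤
      (degree f + 1) * (degree g + 1) * (height f + 1) * (height g + 1) :=
    (hrank.trans (Nat.mul_le_mul hWN hWN')).trans_eq (by ring)
  obtain ⟨B, hB0, hBN, hB⟩ := exists_annihilator_of_stable _
    (cartier_mem_map₂_lamperti _ _ _ hW hW') hN (Nat.succ_le_of_lt (by positivity))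
    (Submodule.apply_mem_map₂ _ hfW hgW')
  obtain ⟨B', hB', hBB'⟩ := exists_annihilator_of_map (f := lamperti α β γ f g) (B := B)
    ⟨hB0, by rw [map_lamperti]; exact hB⟩
  exact ⟨(isAlg_iff _).2 ⟨B', hB'⟩,
    (Nat.sInf_le (Set.mem_image_of_mem Polynomial.natDegree hB')).trans (hBB'.trans hBN)⟩

lemma hadamard_eq_lamperti {k : Type*} [Field k] (f g : PowerSeries k) :
    hadamard f g = lamperti 0 0 1 f g := by
  ext i
  rw [hadamard, lamperti, PowerSeries.coeff_mk, PowerSeries.coeff_mk,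
    -- With α = β = 0 only j = l = 0 survives, where 0⁰ = 1.
    Finset.sum_eq_single ![0, i, 0]]
  · simp [Nat.div_self (Nat.factorial_pos i)]
  · intro x hx hne
    rw [Finset.Nat.mem_antidiagonalTuple, Fin.sum_univ_three] at hx
    by_cases h0 : x 0 = 0
    · by_cases h2 : x 2 = 0
      · exfalso
        apply hne
        ext s
        fin_cases s
        · exact h0
        · show x 1 = i
          omega
        · exact h2
      · simp [h2]
    · simp [h0]
  · intro h
    exact absurd (by simp [Finset.Nat.mem_antidiagonalTuple, Fin.sum_univ_three]) h

lemma hurwitz_eq_lamperti {k : Type*} [Field k] (f g : PowerSeries k) :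
    hurwitz f g = lamperti 1 1 0 f g := by
  ext i
  rw [hurwitz, lamperti, PowerSeries.coeff_mk, PowerSeries.coeff_mk]
  -- With γ = 0 only the triples with m = 0 survive; they are indexed by j ≤ i.
  have h1 : (Finset.range (i + 1)).image (fun j => ![j, 0, i - j]) ⊆
      Finset.Nat.antidiagonalTuple 3 i := by
    intro x hx
    obtain ⟨j, hj, rfl⟩ := Finset.mem_image.1 hx
    have := Finset.mem_range.1 hj
    rw [Finset.Nat.mem_antidiagonalTuple, Fin.sum_univ_three]
    show j + 0 + (i - j) = i
    omega
  rw [← Finset.sum_subset h1, Finset.sum_image]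
  · refine Finset.sum_congr rfl fun j hj => ?_
    rw [Nat.choose_eq_factorial_div_factorial (Nat.lt_succ_iff.1 (Finset.mem_range.1 hj))]
    simp
  · intro a _ b _ hab
    exact congrFun hab 0
  · intro x hx hx'
    rw [Finset.Nat.mem_antidiagonalTuple, Fin.sum_univ_three] at hx
    have h2 : x 1 ≠ 0 := by
      intro h2
      apply hx'
      refine Finset.mem_image.2 ⟨x 0, Finset.mem_range.2 (by omega), ?_⟩
      ext s
      fin_cases s
      · rfl
      · exact h2.symm
      · show i - x 0 = x 2
        omega
    simp [h2]

end AlgSeries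

end

theorem theorem8 {k : Type*} [Field k] {p : ℕ} (hp : p.Prime) [CharP k p]
    (f g : PowerSeries k) (hf : AlgSeries.IsAlg f) (hg : AlgSeries.IsAlg g)
    (d d' h h' N : ℕ)
    (hd : AlgSeries.degree f = d) (hd' : AlgSeries.degree g = d')
    (hh : AlgSeries.height f = h) (hh' : AlgSeries.height g = h')
    (hN : N = (d + 1) * (d' + 1) * (h + 1) * (h' + 1)) :
    (∀ α β γ : k, AlgSeries.IsAlg (AlgSeries.lamperti α β γ f g) ∧
      AlgSeries.degree (AlgSeries.lamperti α β γ f g) ≤ p ^ N - 1) ∧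
    (AlgSeries.IsAlg (AlgSeries.hadamard f g) ∧
      AlgSeries.degree (AlgSeries.hadamard f g) ≤ p ^ N - 1) ∧
    (AlgSeries.IsAlg (AlgSeries.hurwitz f g) ∧
      AlgSeries.degree (AlgSeries.hurwitz f g) ≤ p ^ N - 1) := by
  have : Fact p.Prime := ⟨hp⟩
  subst hd hd' hh hh' hN
  rw [AlgSeries.hadamard_eq_lamperti, AlgSeries.hurwitz_eq_lamperti]
  have H := AlgSeries.isAlg_lamperti_and_degree_le (p := p) hf hg
  exact ⟨H, H 0 0 1, H 1 1 0⟩
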